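/- **Setting.** Fix $n\ge 0$ and a commutative ring $R$. Manifolds are topological manifolds, possibly with boundary. A *gluing* $g:X\to X'=X\cup_Y\circlearrowleft$ of $n$-manifolds is the quotient map identifying, by a homeomorphism, two disjoint (locally flat, closed, possibly empty) codimension $0$ submanifolds $Y$, $Y^{op}$ of $\partial X$; it is required that $X'$ is a manifold. An *iterated gluing* is a finite nonempty sequence of gluings. A *disk-like $n$-category* $\mathcal C$ enriched in chain complexes of $R$-modules consists of the following. * For $k<n$: sets $\mathcal C_k(X)$ for $k$-balls $X$, functorial in homeomorphisms; natural boundary maps $\mathcal C_k(X)\to \underline{\mathcal C}_{k-1}(\partial X)$, where $\underline{\mathcal C}_{k-1}(S)$ is the colimit, over permissible decompositions of $S$ into $(k-1)$-balls, of the sets of families of labels of the balls that agree on shared boundaries; and injective, strictly associative and natural compositions for $k$-balls $B=B_1\cup_Y B_2$ glued along $(k-1)$-balls $Y$, defined whenever the boundaries split along $\partial Y$ and agree on $Y$. * For $k=n$: chain complexes $\mathcal C(X;c)$ for $n$-balls $X$ with a boundary condition $c\in\underline{\mathcal C}_{n-1}(\partial X)$, with an action of homeomorphisms and composition chain maps $\mathcal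 C(B_1;c_1)\otimes\mathcal C(B_2;c_2)\to\mathcal C(B;c)$ that are strictly associative, natural, and symmetric with Koszul signs: the map induced by a sequence of homeomorphisms, reorderings and gluings of balls, all of whose stages are disjoint unions of balls, depends only on the resulting map between disjoint unions. (Complexes concentrated in degree $0$ give ordinary $n$-categories enriched in $R$-modules. Product morphisms, isotopy invariance and actions of families of homeomorphisms are not needed.) A *permissible decomposition* of $W$ is a map $\bigsqcup_a X_a\to W$ from a finite disjoint union of balls that is a composite of gluings of manifolds, up to homeomorphism. A *labelled decomposition* of an $n$-manifold $W$ is a permissible decomposition into $n$-balls $X_a$ with boundary conditions $\beta_a\in\underline{\mathcal C}_{n-1}(\partial X_a)$ that split along, and agree on, shared boundaries. It *refines* another one, $x\to y$, if $y$ is obtained from it by gluing balls to balls through stages which are all disjoint unions of balls, composing boundary conditions. Put $\psi(x)=\bigotimes_a\mathcal C(X_a;\beta_a)$; composition in $\mathcal C$ makes $\psi$ a functor on labelled decompositions and refinements. The *blob complex* $\mathcal B_*(W)=\mathcal B_*(W;\mathcal C)$ is the homotopy colimit of $\psi$: it is $\bigoplus_{m}\bigoplus_{\bar x=(x_0\to\cdots\to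 x_m)}\psi(x_0)[m]$ with differential $$\partial(\bar x,a)=(\bar x,\partial a)+(-1)^{\deg a}\Big((d_0\bar x,\psi(x_0\to x_1)a)+\sum_{i=1}^m(-1)^i(d_i\bar x,a)\Big).$$ For a class $Q$ of labelled decompositions of $W$ let $\mathcal B_*(W)_Q\subseteq\mathcal B_*(W)$ be the subcomplex spanned by the $(\bar x,a)$ with all $x_i$ in $Q$. For a gluing $g:X\to X'$ and a class $Q$ of labelled decompositions of $X'$ let $g^*Q$ be the class of all labelled decompositions $x$ of $X$ whose labels split along and agree on $Y$ and $Y^{op}$ (so that $g\circ x$ is a labelled decomposition of $X'$), with $g\circ x\in Q$. When $Q$ consists of all labelled decompositions of $X'$, $\mathcal B_*(X)_{g^*Q}$ is the part of $\mathcal B_*(X)$ with matching boundary conditions along $Y$ and $Y^{op}$. A homeomorphism $b:X\to W$ induces $b_*(\bar x,a)=(b\circ\bar x,a)$; pull back classes along $b$ by $b^*Q=\{x : b\circ x\in Q\}$. **Property (Gluing map).** Each gluing $g:X\to X'=X\cup_Y\circlearrowleft$ induces a chain map from the part of $\mathcal B_*(X)$ with matching boundary conditions along $Y$ and $Y^{op}$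 to $\mathcal B_*(X')$, natural with respect to homeomorphisms and associative for iterated gluings. Precisely, there are chain maps $$\mathrm{gl}_{g,Q}:\mathcal B_*(X)_{g^*Q}\to\mathcal B_*(X')_Q,$$ for all gluings $g:X\to X'$ of $n$-manifolds and all classes $Q$ of labelled decompositions of $X'$, such that: 1. $\mathrm{gl}_{g,Q}(\bar x,a)=(g\circ\bar x,a)$ for all $\bar x=(x_0\to\cdots\to x_m)$ in $g^*Q$ and all $a\in\psi(x_0)=\psi(g\circ x_0)$. 2. (Naturality.) If $g:X\to X'$ and $h:W\to W'$ are gluings and $a:X\to W$, $b:X'\to W'$ are homeomorphisms with $h\circ a=b\circ g$, then $a^*h^*Q=g^*b^*Q$ for every class $Q$ of labelled decompositions of $W'$, and $\mathrm{gl}_{h,Q}\circ a_*=b_*\circ\mathrm{gl}_{g,b^*Q}$ on $\mathcal B_*(X)_{g^*b^*Q}$. 3. (Associativity.) For an iterated gluing $s=(X\xrightarrow{g_1}\cdots\xrightarrow{g_r}W)$ let $s^*Q=g_1^*\cdots g_r^*Q$ and let $\mathrm{gl}_{s,Q}:\mathcal B_*(X)_{s^*Q}\to\mathcal B_*(W)_Q$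 be the composite of the maps $\mathrm{gl}_{g_i}$. If $s$ and $s'$ are iterated gluings from $X$ to $W$ with the same composite map $X\to W$, then $\mathrm{gl}_{s,Q}=\mathrm{gl}_{s',Q}$ on $\mathcal B_*(X)_{s^*Q\cap s'^*Q}$, for every class $Q$ of labelled decompositions of $W$. -/

import Mathlib

open CategoryTheory Limits MonoidalCategory

noncomputable section

namespace Blob

/-! ## Manifolds, balls and gluings (topological category) -/

/-- The points of `M` without an open neighbourhood homeomorphic to `ℝᵏ`; for a topological
`k`-manifold with boundary `M` this is `∂M`. -/
def bdry (k : ℕ) (M : Type) [TopologicalSpace M] : Set M :=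
  {p | ¬ ∃ U : Set M, IsOpen U ∧ p ∈ U ∧ Nonempty (U ≃ₜ (Fin k → ℝ))}

/-- Topological `k`-manifolds, possibly with boundary (and possibly empty). -/
structure IsMfd (k : ℕ) (M : Type) [TopologicalSpace M] : Prop where
  t2 : T2Space M
  secondCountable : SecondCountableTopology M
  chart : ∀ p : M, ∃ U : Set M, IsOpen U ∧ p ∈ U ∧
    (Nonempty (U ≃ₜ (Fin k → ℝ)) ∨ ∃ i : Fin k, Nonempty (U ≃ₜ {v : Fin k → ℝ // 0 ≤ v i}))

/-- `Y ⊆ ∂M` is a (locally flat, closed) codimension 0 submanifold of the `(k-1)`-manifold `∂M`: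
near each point of its frontier in `∂M`, the pair `(∂M, Y)` looks like a closed half-space
in `ℝᵏ⁻¹`. -/
structure IsCodimZero (k : ℕ) {M : Type} [TopologicalSpace M] (Y : Set M) : Prop where
  subset : Y ⊆ bdry k M
  closed : IsClosed {p : bdry k M | (p : M) ∈ Y}
  flat : ∀ p ∈ frontier {p : bdry k M | (p : M) ∈ Y}, ∃ U : Set (bdry k M), IsOpen U ∧ p ∈ U ∧
    ∃ (e : U ≃ₜ (Fin (k - 1) → ℝ)) (i : Fin (k - 1)), ∀ u : U, ((u : bdry k M) : M) ∈ Y ↔ 0 ≤ e u i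

/-- `g : M → N` is a gluing of `k`-manifolds: `∂M` contains two disjoint codimension 0
submanifolds `Y` and `Y'` and a homeomorphism `φ : Y ≅ Y'`, and `g` is the quotient map which
identifies each `y ∈ Y` with `φ y`. (The empty set is allowed for `Y`.) -/
structure IsGluing (k : ℕ) {M N : Type} [TopologicalSpace M] [TopologicalSpace N]
    (g : M → N) : Prop where
  source : IsMfd k M
  target : IsMfd k N
  quotient : Topology.IsQuotientMap g
  glued : ∃ Y Y' : Set M, IsCodimZero k Y ∧ IsCodimZero k Y' ∧ Disjoint Y Y' ∧ ∃ φ : Y ≃ₜ Y',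
    ∀ p q : M, g p = g q ↔
      p = q ∨ (∃ hp : p ∈ Y, (φ ⟨p, hp⟩ : M) = q) ∨ (∃ hq : q ∈ Y, (φ ⟨q, hq⟩ : M) = p)

/-- `Assembles k f`: the map `f : M → N` is a composite of a sequence of gluings
`M = M₀ → M₁ → ⋯ → M_m = N` of `k`-manifolds (up to a homeomorphism, which is all there is
when `m = 0`). -/
inductive Assembles (k : ℕ) : ∀ {M N : Type} [TopologicalSpace M] [TopologicalSpace N],
    (M → N) → Prop
  | homeo {M N : Type} [TopologicalSpace M] [TopologicalSpace N] (e : M ≃ₜ N) : Assembles k e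
  | step {M M' N : Type} [TopologicalSpace M] [TopologicalSpace M'] [TopologicalSpace N]
      (f : M → M') (g : M' → N) : Assembles k f → IsGluing k g → Assembles k (g ∘ f)

lemma IsMfd.homeo {k : ℕ} {M N : Type} [TopologicalSpace M] [TopologicalSpace N]
    (hM : IsMfd k M) (h : M ≃ₜ N) : IsMfd k N where
  t2 := by
    have := hM.t2
    exact h.t2Space
  secondCountable := by
    have := hM.secondCountable
    exact h.symm.secondCountableTopology
  chart p := by
    obtain ⟨U, hU, hp, hc⟩ := hM.chart (h.symm p)
    refine ⟨h '' U, h.isOpenMap U hU, ⟨h.symm p, hp, h.apply_symm_apply p⟩, ?_⟩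
    rcases hc with ⟨⟨e⟩⟩ | ⟨i, ⟨e⟩⟩
    · exact Or.inl ⟨(h.image U).symm.trans e⟩
    · exact Or.inr ⟨i, ⟨(h.image U).symm.trans e⟩⟩

lemma IsGluing.comp_homeo {k : ℕ} {M N N' : Type} [TopologicalSpace M] [TopologicalSpace N]
    [TopologicalSpace N'] {g : M → N} (hg : IsGluing k g) (h : N ≃ₜ N') : IsGluing k (h ∘ g) where
  source := hg.source
  target := hg.target.homeo h
  quotient := h.isQuotientMap.comp hg.quotient
  glued := by
    obtain ⟨Y, Y', hY, hY', hd, φ, hφ⟩ := hg.glued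
    refine ⟨Y, Y', hY, hY', hd, φ, fun p q => ?_⟩
    rw [← hφ p q]
    exact h.injective.eq_iff

lemma Assembles.comp_homeo {k : ℕ} {M N N' : Type} [TopologicalSpace M] [TopologicalSpace N]
    [TopologicalSpace N'] {f : M → N} (hf : Assembles k f) (h : N ≃ₜ N') :
    Assembles k (h ∘ f) := by
  cases hf with
  | homeo e => exact Assembles.homeo (e.trans h)
  | step f g hf hg => exact Assembles.step f (h ∘ g) hf (hg.comp_homeo h)

/-- A `k`-ball: a space homeomorphic to the standard closed ball. -/
structure Bal (k : ℕ) : Type 1 where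
  carrier : Type
  [top : TopologicalSpace carrier]
  isBall : Nonempty (carrier ≃ₜ Metric.closedBall (0 : EuclideanSpace ℝ (Fin k)) 1)

attribute [instance] Bal.top

instance (k : ℕ) : CoeSort (Bal k) Type := ⟨Bal.carrier⟩

/-- A presentation `B = B₁ ∪_Y B₂` of a `k`-ball as a union of two `k`-balls, glued along
a `(k-1)`-ball `Y`. -/
structure BallGluing {k : ℕ} (B₁ B₂ B : Bal k) : Type where
  i₁ : B₁ → B
  i₂ : B₂ → B
  cont₁ : Continuous i₁
  cont₂ : Continuous i₂
  inj₁ : Function.Injective i₁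
  inj₂ : Function.Injective i₂
  cover : Set.range i₁ ∪ Set.range i₂ = Set.univ
  codim₁ : IsCodimZero k (i₁ ⁻¹' Set.range i₂)
  codim₂ : IsCodimZero k (i₂ ⁻¹' Set.range i₁)
  ball : Nonempty (↥(i₁ ⁻¹' Set.range i₂) ≃ₜ
    Metric.closedBall (0 : EuclideanSpace ℝ (Fin (k - 1))) 1)

/-! ## Labelled balls and sequences of gluings of balls -/

/-- A ball together with a label. -/
structure LBal {k : ℕ} (L : Bal k → Type 1) : Type 1 where
  ball : Bal k
  lab : L ball

section Decompositions

variable {k : ℕ} {L : Bal k → Type 1}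

/-- The disjoint union of a finite list of balls. -/
def Tot : List (LBal L) → Type
  | [] => Empty
  | a :: l => a.ball ⊕ Tot l

instance Tot.top : (l : List (LBal L)) → TopologicalSpace (Tot l)
  | [] => inferInstanceAs (TopologicalSpace Empty)
  | a :: l => @instTopologicalSpaceSum a.ball (Tot l) _ (Tot.top l)

/-- The inclusion of the `i`-th ball in the disjoint union. -/
def inc : (l : List (LBal L)) → (i : Fin l.length) → (l.get i).ball → Tot l
  | _ :: _, ⟨0, _⟩ => fun x => Sum.inl x
  | _ :: l, ⟨i + 1, h⟩ => fun x => Sum.inr (inc l ⟨i, Nat.lt_of_succ_lt_succ h⟩ x)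

/-- The map on a disjoint union `(⊔ l) ⊔ (⊔ l')` given by maps on the two parts. -/
def join {S : Type} : (l l' : List (LBal L)) → (Tot l → S) → (Tot l' → S) → Tot (l ++ l') → S
  | [], _, _, f' => f'
  | _ :: l, l', f, f' => Sum.elim (fun x => f (Sum.inl x)) (join l l' (fun x => f (Sum.inr x)) f')

/-- The relations describing what homeomorphisms and gluings of balls do to labels: `hom h a b`
means that `h` carries the label `a` to `b`, and `gl G a b c` that `a` and `b` may be
glued to `c`. -/
structure Ops (L : Bal k → Type 1) : Type 1 where
  hom : ∀ {X Y : Bal k}, (X ≃ₜ Y) → L X → L Y → Prop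
  gl : ∀ {B₁ B₂ B : Bal k}, BallGluing B₁ B₂ B → L B₁ → L B₂ → L B → Prop

/-- Elementary moves between disjoint unions of labelled balls: apply a homeomorphism to one ball,
change the order of the list, or glue two balls to one ball. -/
inductive Step (O : Ops L) : List (LBal L) → List (LBal L) → Type 1
  | homeo (a b : LBal L) (l : List (LBal L)) (h : a.ball ≃ₜ b.ball) (hl : O.hom h a.lab b.lab) :
      Step O (a :: l) (b :: l)
  | swap (a b : LBal L) (l : List (LBal L)) : Step O (a :: b :: l) (b :: a :: l)
  | glue (a b c : LBal L) (l : List (LBal L)) (G : BallGluing a.ball b.ball c.ball)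
      (hl : O.gl G a.lab b.lab c.lab) : Step O (a :: b :: l) (c :: l)
  | cons (a : LBal L) {l l' : List (LBal L)} (s : Step O l l') : Step O (a :: l) (a :: l')

/-- The map of disjoint unions underlying an elementary move. -/
def Step.toFun {O : Ops L} : {l l' : List (LBal L)} → Step O l l' → Tot l → Tot l'
  | _, _, .homeo _ _ _ h _ => Sum.map h id
  | _, _, .swap _ _ _ => Sum.elim (fun x => Sum.inr (Sum.inl x))
      (Sum.elim (fun x => Sum.inl x) (fun x => Sum.inr (Sum.inr x)))
  | _, _, .glue _ _ _ _ G _ => Sum.elim (fun x => Sum.inl (G.i₁ x))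
      (Sum.elim (fun x => Sum.inl (G.i₂ x)) (fun x => Sum.inr x))
  | _, _, .cons _ s => Sum.map id s.toFun

/-- A sequence of elementary moves. All intermediate stages are disjoint unions of balls. -/
inductive Path (O : Ops L) : List (LBal L) → List (LBal L) → Type 1
  | nil (l : List (LBal L)) : Path O l l
  | cons {l l' l'' : List (LBal L)} (s : Step O l l') (p : Path O l' l'') : Path O l l''

/-- The map of disjoint unions underlying a sequence of elementary moves. -/
def Path.toFun {O : Ops L} : {l l' : List (LBal L)} → Path O l l' → Tot l → Tot l'
  | _, _, .nil _ => id
  | _, _, .cons s p => p.toFun ∘ s.toFun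

/-- Concatenation of sequences of moves. -/
def Path.append {O : Ops L} : {l l' l'' : List (LBal L)} → Path O l l' → Path O l' l'' →
    Path O l l''
  | _, _, _, .nil _, q => q
  | _, _, _, .cons s p, q => .cons s (p.append q)

lemma Path.append_toFun {O : Ops L} {l l' l'' : List (LBal L)} (p : Path O l l')
    (q : Path O l' l'') : (p.append q).toFun = q.toFun ∘ p.toFun := by
  induction p with
  | nil _ => rfl
  | cons s p ih => simp only [Path.append, Path.toFun, ih]; rfl

/-- A finite family of labelled balls with a map from their disjoint union to `S`. -/
structure RawDec (L : Bal k → Type 1) (S : Type) : Type 1 where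
  pieces : List (LBal L)
  toFun : Tot pieces → S

/-- Composition with a map `S → S'`. -/
def RawDec.push {S S' : Type} (z : RawDec L S) (g : S → S') : RawDec L S' :=
  ⟨z.pieces, g ∘ z.toFun⟩

/-- The union of two families. -/
def RawDec.union {S : Type} (z z' : RawDec L S) : RawDec L S :=
  ⟨z.pieces ++ z'.pieces, join z.pieces z'.pieces z.toFun z'.toFun⟩

end Decompositions

/-! ## The sets of `k`-morphisms, `k < n` -/

/-- The raw data of the `k`-morphisms of an `n`-category for `k < n` (the values for `k ≥ n` are
never used): a set `C X` for each `k`-ball `X`, the maps induced by homeomorphisms, a boundary and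
the composition. `Bd c z` means that the labelled decomposition `z` of `∂X` represents
the boundary of `c`, and `glue G c₁ c₂ c` that `c` is the result of gluing `c₁` and `c₂`. -/
structure CellData : Type 2 where
  C : {k : ℕ} → Bal k → Type 1
  map : {k : ℕ} → {X Y : Bal k} → (X ≃ₜ Y) → C X → C Y
  Bd : {k : ℕ} → {X : Bal k} → C X → RawDec (k := k - 1) C (bdry k X) → Prop
  glue : {k : ℕ} → {B₁ B₂ B : Bal k} → BallGluing B₁ B₂ B → C B₁ → C B₂ → C B → Prop

namespace CellData

variable (A : CellData)

/-- Homeomorphisms and gluings acting on the sets of `k`-morphisms. -/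
def ops (k : ℕ) : Ops (k := k) A.C where
  hom h a b := A.map h a = b
  gl G a b c := A.glue G a b c

/-- The map to `S` from the `u`-th ball of a decomposition `wᵢ` of `∂Xᵢ`, for the `i`-th ball `Xᵢ`
of the family `z` of balls over `S`. -/
def faceMap {k : ℕ} {L : Bal k → Type 1} {S : Type} (z : RawDec L S)
    (w : ∀ i : Fin z.pieces.length, RawDec (k := k - 1) A.C (bdry k (z.pieces.get i).ball))
    (i : Fin z.pieces.length) (u : Fin (w i).pieces.length) : ((w i).pieces.get u).ball → S :=
  fun x => z.toFun (inc z.pieces i ((w i).toFun (inc (w i).pieces u x)))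

/-- The labels of the balls `Xᵢ` of `z` agree on shared boundaries. `Rep a w` means that the
labelled decomposition `w` of `∂X` into `(k-1)`-balls represents the boundary of the label `a`.
The boundary of each label has to split along a decomposition `wᵢ` of `∂Xᵢ` into labelled
`(k-1)`-balls ("faces") such that two distinct faces whose interiors meet in `S` are the same face
of `S` (they are identified by a homeomorphism over `S`), with the same label. -/
def FacesAgree {k : ℕ} {L : Bal k → Type 1}
    (Rep : ∀ {X : Bal k}, L X → RawDec (k := k - 1) A.C (bdry k X) → Prop)
    {S : Type} (z : RawDec L S) : Prop :=
  ∃ w : ∀ i : Fin z.pieces.length, RawDec (k := k - 1) A.C (bdry k (z.pieces.get i).ball),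
    (∀ i, Rep (z.pieces.get i).lab (w i)) ∧
    (∀ i u, Set.InjOn (A.faceMap z w i u) (bdry (k - 1) ((w i).pieces.get u).ball)ᶜ) ∧
    ∀ i u j v, (⟨i, u⟩ : Σ i, Fin (w i).pieces.length) ≠ ⟨j, v⟩ →
      (∃ p ∈ (bdry (k - 1) ((w i).pieces.get u).ball)ᶜ,
        ∃ q ∈ (bdry (k - 1) ((w j).pieces.get v).ball)ᶜ,
          A.faceMap z w i u p = A.faceMap z w j v q) →
      ∃ h : ((w i).pieces.get u).ball ≃ₜ ((w j).pieces.get v).ball,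
        (∀ x, A.faceMap z w j v (h x) = A.faceMap z w i u x) ∧
          A.map h ((w i).pieces.get u).lab = ((w j).pieces.get v).lab

lemma FacesAgree.push_iff {k : ℕ} {L : Bal k → Type 1}
    (Rep : ∀ {X : Bal k}, L X → RawDec (k := k - 1) A.C (bdry k X) → Prop)
    {S S' : Type} (z : RawDec L S) (f : S → S') (hf : Function.Injective f) :
    A.FacesAgree Rep (z.push f) ↔ A.FacesAgree Rep z := by
  constructor
  · rintro ⟨w, hw, h1, h2⟩
    refine ⟨w, hw, fun i u p hp q hq hpq => h1 i u hp hq (congrArg f hpq), ?_⟩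
    rintro i u j v hne ⟨p, hp, q, hq, hpq⟩
    obtain ⟨h, hh, hl⟩ := h2 i u j v hne ⟨p, hp, q, hq, congrArg f hpq⟩
    exact ⟨h, fun x => hf (hh x), hl⟩
  · rintro ⟨w, hw, h1, h2⟩
    refine ⟨w, hw, fun i u p hp q hq hpq => h1 i u hp hq (hf hpq), ?_⟩
    rintro i u j v hne ⟨p, hp, q, hq, hpq⟩
    obtain ⟨h, hh, hl⟩ := h2 i u j v hne ⟨p, hp, q, hq, hf hpq⟩
    exact ⟨h, fun x => congrArg f (hh x), hl⟩

/-- `z` is a permissible decomposition of `S` into balls, with labels which agree on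
shared boundaries. -/
structure Good {k : ℕ} {L : Bal k → Type 1}
    (Rep : ∀ {X : Bal k}, L X → RawDec (k := k - 1) A.C (bdry k X) → Prop)
    {S : Type} [TopologicalSpace S] (z : RawDec L S) : Prop where
  permissible : Assembles k z.toFun
  agree : A.FacesAgree Rep z

/-- Permissible decompositions of `S` into `k`-balls with compatible labels by `k`-morphisms. -/
def Dec (k : ℕ) (S : Type) [TopologicalSpace S] : Type 1 :=
  {z : RawDec (k := k) A.C S // A.Good A.Bd z}

/-- The refinement relation: the second labelled decomposition is obtained from
the first one by gluing balls to balls, and composing the labels. -/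
def Refines {k : ℕ} {S : Type} [TopologicalSpace S] (z z' : A.Dec k S) : Prop :=
  ∃ p : Path (A.ops k) z.1.pieces z'.1.pieces, z'.1.toFun ∘ p.toFun = z.1.toFun

/-- The extension of the `k`-morphisms from `k`-balls to `k`-manifolds `S`: the colimit, over
the permissible decompositions of `S`, of the sets of compatible labels. -/
def Ext (k : ℕ) (S : Type) [TopologicalSpace S] : Type 1 := Quot (A.Refines (k := k) (S := S))

/-- The labelled decomposition `z` of `S` represents the element `e` of the colimit. -/
def Represents {k : ℕ} {S : Type} [TopologicalSpace S] (e : A.Ext k S)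
    (z : RawDec (k := k) A.C S) : Prop :=
  ∃ h : A.Good A.Bd z, Quot.mk _ ⟨z, h⟩ = e

/-- The type of boundary conditions for a `k`-ball. -/
abbrev BdCond {k : ℕ} (X : Bal k) : Type 1 := A.Ext (k - 1) (bdry k X)

/-- `e` is the boundary of the `k`-morphism `c`. -/
def HasBd {k : ℕ} {X : Bal k} (c : A.C X) (e : A.BdCond X) : Prop :=
  ∀ z, A.Bd c z ↔ A.Represents e z

/-- The homeomorphism `h : X ≅ Y` carries the boundary condition `e` to `e'`. -/
def HomBd {k : ℕ} {X Y : Bal k} (h : X ≃ₜ Y) (e : A.BdCond X) (e' : A.BdCond Y) : Prop :=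
  ∃ j : bdry k X → bdry k Y, (∀ p, (j p : Y) = h p) ∧
    ∃ z, A.Represents e z ∧ A.Represents e' (z.push j)

/-- With `j : P → S` and `j' : Q → S` the inclusions of two pieces covering `S`: the element `e`
over `S` splits, as the result of gluing `eP` over `P` and `eQ` over `Q`. -/
def Splits {k : ℕ} {S P Q : Type} [TopologicalSpace S] [TopologicalSpace P] [TopologicalSpace Q]
    (j : P → S) (j' : Q → S) (e : A.Ext k S) (eP : A.Ext k P) (eQ : A.Ext k Q) : Prop :=
  ∃ z z', A.Represents eP z ∧ A.Represents eQ z' ∧ A.Represents e ((z.push j).union (z'.push j'))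

/-- Boundary conditions `e₁`, `e₂` and `e` for the balls in `B = B₁ ∪_Y B₂`: with `Zᵢ` the closure
of `∂Bᵢ ∖ Y`, the boundary condition `e₁` splits along `∂Y` into `eY` and `e₁'` on `Z₁`, likewise
`e₂` splits into the same `eY` and `e₂'` on `Z₂`, and `e` is glued from `e₁'` and `e₂'`. -/
def GluesBd {k : ℕ} {B₁ B₂ B : Bal k} (G : BallGluing B₁ B₂ B)
    (e₁ : A.BdCond B₁) (e₂ : A.BdCond B₂) (e : A.BdCond B) : Prop :=
  ∃ (y₁ : ↥(G.i₁ ⁻¹' Set.range G.i₂) → bdry k B₁) (y₂ : ↥(G.i₁ ⁻¹' Set.range G.i₂) → bdry k B₂)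
    (z₁ : ↥(closure (bdry k B₁ \ G.i₁ ⁻¹' Set.range G.i₂)) → bdry k B₁)
    (z₂ : ↥(closure (bdry k B₂ \ G.i₂ ⁻¹' Set.range G.i₁)) → bdry k B₂)
    (w₁ : ↥(closure (bdry k B₁ \ G.i₁ ⁻¹' Set.range G.i₂)) → bdry k B)
    (w₂ : ↥(closure (bdry k B₂ \ G.i₂ ⁻¹' Set.range G.i₁)) → bdry k B),
    (∀ p, (y₁ p : B₁) = p) ∧ (∀ p, G.i₂ (y₂ p) = G.i₁ p) ∧
    (∀ p, (z₁ p : B₁) = p) ∧ (∀ p, (z₂ p : B₂) = p) ∧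
    (∀ p, (w₁ p : B) = G.i₁ p) ∧ (∀ p, (w₂ p : B) = G.i₂ p) ∧
    ∃ eY e₁' e₂', A.Splits y₁ z₁ e₁ eY e₁' ∧ A.Splits y₂ z₂ e₂ eY e₂' ∧ A.Splits w₁ w₂ e e₁' e₂'

/-- The axioms for `k`-morphisms with `k < n`: functoriality, boundaries, composition and strict
associativity. (Naturality of the composition with respect to homeomorphisms is the case
of `assoc` for sequences of moves that involve homeomorphisms.) -/
structure Axioms (n : ℕ) : Prop where
  map_id : ∀ k < n, ∀ (X : Bal k) (c : A.C X), A.map (Homeomorph.refl X) c = c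
  map_comp : ∀ k < n, ∀ (X Y Z : Bal k) (h : X ≃ₜ Y) (h' : Y ≃ₜ Z) (c : A.C X),
    A.map (h.trans h') c = A.map h' (A.map h c)
  /-- every morphism has a boundary -/
  bd : ∀ k < n, ∀ (X : Bal k) (c : A.C X), ∃ e, A.HasBd c e
  /-- the boundary is natural -/
  bd_natural : ∀ k < n, ∀ (X Y : Bal k) (h : X ≃ₜ Y) (c : A.C X) (e : A.BdCond X)
    (e' : A.BdCond Y), A.HasBd c e → A.HomBd h e e' → A.HasBd (A.map h c) e'
  /-- morphisms with matching, splittable boundaries have a composite, with the expected boundary -/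
  comp : ∀ k < n, ∀ (B₁ B₂ B : Bal k) (G : BallGluing B₁ B₂ B) (c₁ : A.C B₁) (c₂ : A.C B₂) e₁ e₂ e,
    A.HasBd c₁ e₁ → A.HasBd c₂ e₂ → A.GluesBd G e₁ e₂ e → ∃ c, A.glue G c₁ c₂ c ∧ A.HasBd c e
  /-- only such morphisms can be composed -/
  comp_bd : ∀ k < n, ∀ (B₁ B₂ B : Bal k) (G : BallGluing B₁ B₂ B) (c₁ : A.C B₁) (c₂ : A.C B₂)
    (c : A.C B), A.glue G c₁ c₂ c →
      ∃ e₁ e₂ e, A.HasBd c₁ e₁ ∧ A.HasBd c₂ e₂ ∧ A.HasBd c e ∧ A.GluesBd G e₁ e₂ e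
  /-- composition is injective -/
  comp_inj : ∀ k < n, ∀ (B₁ B₂ B : Bal k) (G : BallGluing B₁ B₂ B) (c₁ c₁' : A.C B₁)
    (c₂ c₂' : A.C B₂) (c : A.C B), A.glue G c₁ c₂ c → A.glue G c₁' c₂' c → c₁ = c₁' ∧ c₂ = c₂'
  /-- strict associativity: given a decomposition of a ball `B` into smaller labelled balls, any
  two sequences of gluings which assemble it yield the same morphism -/
  assoc : ∀ k < n, ∀ (l : List (LBal (k := k) A.C)) (B : Bal k) (c c' : A.C B)
    (p : Path (A.ops k) l [⟨B, c⟩]) (q : Path (A.ops k) l [⟨B, c'⟩]),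
    (p.toFun : Tot l → B ⊕ Empty) = q.toFun → c = c'

/-- Homeomorphisms and gluings acting on boundary conditions of `k`-balls. -/
def bdOps (k : ℕ) : Ops (k := k) A.BdCond where
  hom h e e' := A.HomBd h e e'
  gl G e₁ e₂ e := A.GluesBd G e₁ e₂ e

end CellData

end Blob

/-! ## Chain complexes -/

instance downTensorSigns : (ComplexShape.down ℤ).TensorSigns where
  ε' := MonoidHom.mk' (fun (i : Multiplicative ℤ) => Int.negOnePow i.toAdd)
    (fun a b => Int.negOnePow_add a.toAdd b.toAdd)
  rel_add p q r hpq := by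
    change q + 1 = p at hpq
    change q + r + 1 = p + r
    lia
  add_rel p q r hpq := by
    change q + 1 = p at hpq
    change r + q + 1 = r + p
    lia
  ε'_succ := by
    rintro _ q rfl
    change Int.negOnePow q = - Int.negOnePow (q + 1)
    rw [Int.negOnePow_succ, neg_neg]

instance totalShape :
    TotalComplexShape (ComplexShape.down ℤ) (ComplexShape.down ℕ) (ComplexShape.down ℤ) where
  π i := i.1 + (i.2 : ℤ)
  ε₁ _ := 1
  ε₂ i := Int.negOnePow i.1
  rel₁ {p q} h m := by
    change q + 1 = p at h
    change q + (m : ℤ) + 1 = p + (m : ℤ)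
    lia
  rel₂ p {m l} h := by
    change l + 1 = m at h
    change p + (l : ℤ) + 1 = p + (m : ℤ)
    lia
  ε₂_ε₁ {p q m l} h _ := by
    change q + 1 = p at h
    subst h
    simp [Int.negOnePow_succ]


namespace Blob

/-- Chain complexes of `R`-modules (graded by `ℤ`, with differential of degree `-1`). -/
abbrev Ch (R : Type 1) [CommRing R] := ChainComplex (ModuleCat.{1} R) ℤ

section Chains

variable {R : Type 1} [CommRing R]

open HomologicalComplex in
lemma ι_tensor_d (K L : Ch R) (p q i j : ℤ) (h : p + q = i) (hij : j + 1 = i) :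
    ιTensorObj K L p q i h ≫ (HomologicalComplex.tensorObj K L).d i j =
      K.d p (p - 1) ▷ L.X q ≫ ιTensorObj K L (p - 1) q j (by lia) +
      p.negOnePow • (K.X p ◁ L.d q (q - 1) ≫ ιTensorObj K L p (q - 1) j (by lia)) := by
  have hp : (ComplexShape.down ℤ).Rel p (p - 1) := by change p - 1 + 1 = p; lia
  have hq : (ComplexShape.down ℤ).Rel q (q - 1) := by change q - 1 + 1 = q; lia
  rw [mapBifunctor.d_eq, Preadditive.comp_add, mapBifunctor.ι_D₁, mapBifunctor.ι_D₂,
    mapBifunctor.d₁_eq K L (curriedTensor _) _ hp q j (by change p - 1 + q = j; lia),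
    mapBifunctor.d₂_eq K L (curriedTensor _) _ p hq j (by change p + (q - 1) = j; lia)]
  congr 1
  exact one_smul _ _

open HomologicalComplex in
/-- The components of the symmetry of the tensor product of complexes. -/
def koszulSwapX (K L : Ch R) (j : ℤ) :
    (HomologicalComplex.tensorObj K L).X j ⟶ (HomologicalComplex.tensorObj L K).X j :=
  mapBifunctorDesc (fun p q h =>
    (p * q).negOnePow • ((β_ (K.X p) (L.X q)).hom ≫
      ιTensorObj L K q p j ((add_comm q p).trans h)))

open HomologicalComplex in
lemma ι_koszulSwapX (K L : Ch R) (p q j : ℤ) (h : p + q = j) :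
    ιTensorObj K L p q j h ≫ koszulSwapX K L j = (p * q).negOnePow •
      ((β_ (K.X p) (L.X q)).hom ≫ ιTensorObj L K q p j ((add_comm q p).trans h)) :=
  ι_mapBifunctorDesc _ p q h

open HomologicalComplex in
/-- The symmetry `K ⊗ L ⟶ L ⊗ K` of the tensor product of complexes, `x ⊗ y ↦ (-1)^(|x||y|) y ⊗ x`. -/
def koszulSwap (K L : Ch R) :
    HomologicalComplex.tensorObj K L ⟶ HomologicalComplex.tensorObj L K where
  f j := koszulSwapX K L j
  comm' i j hij := by
    change j + 1 = i at hij
    apply mapBifunctor.hom_ext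
    intro p q h
    have h' : p + q = i := h
    have a1 : ((p - 1) * q).negOnePow = (p * q).negOnePow * q.negOnePow := by
      rw [sub_mul, one_mul, Int.negOnePow_sub]
    have a2 : p.negOnePow * (p * (q - 1)).negOnePow = (p * q).negOnePow := by
      rw [mul_sub, mul_one, Int.negOnePow_sub, mul_comm, mul_assoc, Int.units_mul_self, mul_one]
    rw [← Category.assoc, ← Category.assoc, ι_koszulSwapX K L p q i h',
      ι_tensor_d K L p q i j h' hij, Linear.units_smul_comp, Category.assoc,
      ι_tensor_d L K q p i j (by lia) hij, Preadditive.add_comp, Linear.units_smul_comp,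
      Category.assoc, Category.assoc, ι_koszulSwapX, ι_koszulSwapX, Preadditive.comp_add,
      Linear.comp_units_smul, Linear.comp_units_smul, Linear.comp_units_smul, smul_smul, smul_add,
      smul_smul, a1, a2, BraidedCategory.braiding_naturality_left_assoc,
      BraidedCategory.braiding_naturality_right_assoc, add_comm]

end Chains

/-! ## `n`-morphisms -/

/-- The raw data of the `n`-morphisms: a chain complex of morphisms for each `n`-ball with a
boundary condition, the action of homeomorphisms, and the composition. -/
structure TopData (A : CellData) (n : ℕ) (R : Type 1) [CommRing R] : Type 2 where
  T : (X : Bal n) → A.BdCond X → Ch R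
  map : {X Y : Bal n} → (h : X ≃ₜ Y) → {e : A.BdCond X} → {e' : A.BdCond Y} → A.HomBd h e e' →
    (T X e ⟶ T Y e')
  glue : {B₁ B₂ B : Bal n} → (G : BallGluing B₁ B₂ B) →
    {e₁ : A.BdCond B₁} → {e₂ : A.BdCond B₂} → {e : A.BdCond B} → A.GluesBd G e₁ e₂ e →
    (T B₁ e₁ ⊗ T B₂ e₂ ⟶ T B e)

namespace TopData

variable {A : CellData} {n : ℕ} {R : Type 1} [CommRing R] (E : TopData A n R)

/-- The tensor product of the complexes of morphisms of a list of balls with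
boundary conditions. -/
def tens : List (LBal (k := n) A.BdCond) → Ch R
  | [] => 𝟙_ (Ch R)
  | a :: l => E.T a.ball a.lab ⊗ tens l

/-- The chain map induced by an elementary move. -/
def stepMap : {l l' : List (LBal (k := n) A.BdCond)} → Step (A.bdOps n) l l' →
    (E.tens l ⟶ E.tens l')
  | _, _, .homeo _ _ l h hl => E.map h hl ▷ E.tens l
  | _, _, .swap a b l => (α_ (E.T a.ball a.lab) (E.T b.ball b.lab) (E.tens l)).inv ≫
      (koszulSwap (E.T a.ball a.lab) (E.T b.ball b.lab)) ▷ E.tens l ≫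
      (α_ (E.T b.ball b.lab) (E.T a.ball a.lab) (E.tens l)).hom
  | _, _, .glue a b _ l G hl => (α_ (E.T a.ball a.lab) (E.T b.ball b.lab) (E.tens l)).inv ≫
      E.glue G hl ▷ E.tens l
  | _, _, .cons a s => E.T a.ball a.lab ◁ stepMap s

/-- The chain map induced by a sequence of elementary moves. -/
def pathMap : {l l' : List (LBal (k := n) A.BdCond)} → Path (A.bdOps n) l l' →
    (E.tens l ⟶ E.tens l')
  | l, _, .nil _ => 𝟙 (E.tens l)
  | _, _, .cons s p => E.stepMap s ≫ pathMap p

lemma pathMap_append {l l' l'' : List (LBal (k := n) A.BdCond)} (p : Path (A.bdOps n) l l')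
    (q : Path (A.bdOps n) l' l'') : E.pathMap (p.append q) = E.pathMap p ≫ E.pathMap q := by
  induction p with
  | nil _ => simp [Path.append, pathMap]
  | cons s p ih => simp [Path.append, pathMap, ih]

end TopData

/-- The morphisms, boundaries and compositions of a disk-like `n`-category enriched in chain
complexes of `R`-modules. An `n`-category enriched in `R`-modules is the case of complexes
concentrated in degree 0. Identity morphisms (pinched products), isotopy invariance and the action
of families of homeomorphisms play no role for the blob complex as a homotopy colimit,
so that they are not part of the structure. -/
structure DiskCat (n : ℕ) (R : Type 1) [CommRing R] : Type 2 where
  low : CellData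
  axioms_low : low.Axioms n
  top : TopData low n R
  /-- Strict associativity, functoriality and naturality: the map induced by a sequence of moves
  (homeomorphisms, reorderings, gluings) only depends on the resulting map of
  disjoint unions of balls. -/
  assoc : ∀ (l l' : List (LBal (k := n) low.BdCond)) (p q : Path (low.bdOps n) l l'),
    p.toFun = q.toFun → top.pathMap p = top.pathMap q

/-! ## Homotopy colimits -/

section Hocolim

/-- The `m`-simplices of the simplicial replacement of `F`: the coproduct of the `F (x₀)` over
the strings `x = (x₀ ⟶ ⋯ ⟶ x_m)`. -/
def repl {J : Type 1} [Category.{0} J] {V : Type 2} [Category.{1} V]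
    [HasCoproducts.{1} V] (F : J ⥤ V) (m : ℕ) : V :=
  ∐ fun x : ComposableArrows J m => F.obj (x.obj 0)

/-- The inclusion of the summand of the string `x`. -/
def replι {J : Type 1} [Category.{0} J] {V : Type 2} [Category.{1} V]
    [HasCoproducts.{1} V] (F : J ⥤ V) {m : ℕ} (x : ComposableArrows J m) :
    F.obj (x.obj 0) ⟶ repl F m :=
  Limits.Sigma.ι (fun x : ComposableArrows J m => F.obj (x.obj 0)) x

/-- The map `(x, a) ↦ (x ∘ θ, F (x₀ ⟶ x_{θ 0}) a)`. -/
def replMap {J : Type 1} [Category.{0} J] {V : Type 2} [Category.{1} V]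
    [HasCoproducts.{1} V] (F : J ⥤ V) {m m' : ℕ} (θ : Fin (m' + 1) →o Fin (m + 1)) :
    repl F m ⟶ repl F m' :=
  Limits.Sigma.desc fun x : ComposableArrows J m =>
    F.map (x.map (homOfLE (Fin.zero_le (θ 0)))) ≫ replι F (θ.monotone.functor ⋙ x)

section

variable {J : Type 1} [Category.{0} J] {V : Type 2} [Category.{1} V] [HasCoproducts.{1} V]
  (F : J ⥤ V)

lemma repl_hom_ext {m : ℕ} {W : V} {f g : repl F m ⟶ W}
    (h : ∀ x : ComposableArrows J m, replι F x ≫ f = replι F x ≫ g) : f = g :=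
  Limits.Sigma.hom_ext _ _ h

lemma replι_map {m m' : ℕ} (θ : Fin (m' + 1) →o Fin (m + 1)) (x : ComposableArrows J m) :
    replι F x ≫ replMap F θ = F.map (x.map (homOfLE (Fin.zero_le (θ 0)))) ≫
      replι F (θ.monotone.functor ⋙ x) :=
  Limits.Sigma.ι_desc _ _

/-- The map `(x, a) ↦ (Φ x, a)` for a functor `Φ`. -/
def replPush {J' : Type 1} [Category.{0} J'] (Φ : J' ⥤ J) (F : J ⥤ V) (m : ℕ) :
    repl (Φ ⋙ F) m ⟶ repl F m :=
  Limits.Sigma.desc fun x : ComposableArrows J' m => replι F (x ⋙ Φ)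

lemma replι_push {J' : Type 1} [Category.{0} J'] (Φ : J' ⥤ J) (F : J ⥤ V) {m : ℕ}
    (x : ComposableArrows J' m) : replι (Φ ⋙ F) x ≫ replPush Φ F m = replι F (x ⋙ Φ) :=
  Limits.Sigma.ι_desc _ _

lemma replι_naturality {J' : Type 1} [Category.{0} J'] (Φ : J' ⥤ J) (F : J ⥤ V) {m m' : ℕ}
    (θ : Fin (m' + 1) →o Fin (m + 1)) (x : ComposableArrows J' m) :
    replι (Φ ⋙ F) x ≫ replMap (Φ ⋙ F) θ ≫ replPush Φ F m' =
      replι (Φ ⋙ F) x ≫ replPush Φ F m ≫ replMap F θ := by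
  rw [← Category.assoc, replι_map, ← Category.assoc (replι (Φ ⋙ F) x), replι_push]
  refine (Category.assoc _ _ _).trans ?_
  refine (congrArg (fun t => (Φ ⋙ F).map (x.map (homOfLE (Fin.zero_le (θ 0)))) ≫ t)
    (replι_push Φ F (θ.monotone.functor ⋙ x))).trans ?_
  exact (replι_map F θ (x ⋙ Φ)).symm

/-- The simplicial replacement of a functor `F`. -/
def simplicialReplacement : SimplicialObject V where
  obj m := repl F m.unop.len
  map θ := replMap F θ.unop.toOrderHom
  map_id m := by
    apply repl_hom_ext
    intro x
    rw [replι_map, Category.comp_id]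
    have : x.map (homOfLE (Fin.zero_le ((𝟙 m : m ⟶ m).unop.toOrderHom 0))) = 𝟙 _ := x.map_id _
    refine (congrArg (fun t => F.map t ≫ _) this).trans ?_
    refine (congrArg (fun t => t ≫ _) (F.map_id _)).trans ?_
    exact Category.id_comp _
  map_comp {m m' m''} θ θ' := by
    apply repl_hom_ext
    intro x
    refine (replι_map F _ x).trans ?_
    refine Eq.trans ?_ (Category.assoc _ _ _)
    refine Eq.trans ?_ (congrArg (fun t => t ≫ replMap F θ'.unop.toOrderHom)
      (replι_map F θ.unop.toOrderHom x)).symm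
    refine Eq.trans ?_ (Category.assoc _ _ _).symm
    refine Eq.trans ?_ (congrArg (fun t => F.map (x.map (homOfLE
      (Fin.zero_le (θ.unop.toOrderHom 0)))) ≫ t)
      (replι_map F θ'.unop.toOrderHom (θ.unop.toOrderHom.monotone.functor ⋙ x))).symm
    refine Eq.trans ?_ (Category.assoc _ _ _)
    refine congrArg (fun t => t ≫ replι F ((θ ≫ θ').unop.toOrderHom.monotone.functor ⋙ x)) ?_
    refine Eq.trans ?_ (F.map_comp _ _)
    exact congrArg (fun t => F.map t) (x.map_comp _ _)

end

variable {R : Type 1} [CommRing R] {J : Type 1} [Category.{0} J]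

/-- The homotopy colimit of a functor `F` to chain complexes: the total complex of
`⨁ F (x₀)`, the sum over all strings `x₀ ⟶ ⋯ ⟶ x_m` (placed in degree `m`), with differential
`∂ (x, a) = (x, ∂ a) + (-1)^|a| ((d₀ x, F (x₀ ⟶ x₁) a) + ∑_{i ≥ 1} (-1)^i (dᵢ x, a))`. -/
def hocolim (F : J ⥤ Ch R) : Ch R :=
  HomologicalComplex₂.total (C := ModuleCat.{1} R)
    (c₁ := ComplexShape.down ℤ) (c₂ := ComplexShape.down ℕ)
    (HomologicalComplex₂.flip ((AlgebraicTopology.alternatingFaceMapComplex (Ch R)).obj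
      (simplicialReplacement F))) (ComplexShape.down ℤ)

/-- The inclusion `a ↦ (x, a)` of the summand `F (x₀)` of the homotopy colimit which belongs
to the string `x = (x₀ ⟶ ⋯ ⟶ x_m)`. -/
def hocolimι (F : J ⥤ Ch R) {m : ℕ} (x : ComposableArrows J m) (p d : ℤ) (h : p + m = d) :
    (F.obj (x.obj 0)).X p ⟶ (hocolim F).X d :=
  (replι F x).f p ≫
    HomologicalComplex₂.ιTotal (C := ModuleCat.{1} R)
      (c₁ := ComplexShape.down ℤ) (c₂ := ComplexShape.down ℕ)
      (HomologicalComplex₂.flip ((AlgebraicTopology.alternatingFaceMapComplex (Ch R)).obj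
        (simplicialReplacement F))) (ComplexShape.down ℤ) p m d h

/-- The map of homotopy colimits `(x, a) ↦ (Φ x, a)` given by a functor `Φ` of index categories. -/
def hocolimMap {J' : Type 1} [Category.{0} J'] (Φ : J ⥤ J') (F : J' ⥤ Ch R) :
    hocolim (Φ ⋙ F) ⟶ hocolim F :=
  HomologicalComplex₂.total.map (C := ModuleCat.{1} R)
    (c₁ := ComplexShape.down ℤ) (c₂ := ComplexShape.down ℕ)
    ((HomologicalComplex₂.flipFunctor _ _ _).map
      ((AlgebraicTopology.alternatingFaceMapComplex (Ch R)).map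
        { app := fun m => replPush Φ F m.unop.len
          naturality := by
            intro m m' θ
            apply repl_hom_ext
            intro x
            exact replι_naturality Φ F θ.unop.toOrderHom x })) _

end Hocolim

/-! ## The blob complex -/

namespace DiskCat

variable {n : ℕ} {R : Type 1} [CommRing R] (C : DiskCat n R)

/-- Finite lists of `n`-balls with boundary conditions. -/
structure BallList where
  pieces : List (LBal (k := n) C.low.BdCond)

/-- Morphisms are the maps of disjoint unions which arise from sequences of gluings of balls. -/
instance : Category.{0} C.BallList where
  Hom l l' := {φ : Tot l.pieces → Tot l'.pieces //
    ∃ p : Path (C.low.bdOps n) l.pieces l'.pieces, p.toFun = φ}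
  id l := ⟨id, .nil _, rfl⟩
  comp φ ψ := ⟨ψ.1 ∘ φ.1, by
    obtain ⟨_, p, rfl⟩ := φ
    obtain ⟨_, q, rfl⟩ := ψ
    exact ⟨p.append q, p.append_toFun q⟩⟩

/-- The tensor product of the morphism complexes, as a functor via the composition of `C`. -/
def tensFunctor : C.BallList ⥤ Ch R where
  obj l := C.top.tens l.pieces
  map φ := C.top.pathMap φ.2.choose
  map_id l := C.assoc _ _ _ (.nil _) (Exists.choose_spec (Subtype.property (𝟙 l)))
  map_comp φ ψ := by
    rw [← C.top.pathMap_append]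
    apply C.assoc
    rw [Path.append_toFun, φ.2.choose_spec, ψ.2.choose_spec]
    exact Exists.choose_spec (Subtype.property (φ ≫ ψ))

/-- Permissible decompositions of `S` into `n`-balls with compatible boundary conditions, i.e.
permissible decompositions with a labelling of the `(n-1)`-skeleton. -/
structure LabDec (S : Type) [TopologicalSpace S] where
  raw : RawDec (k := n) C.low.BdCond S
  good : C.low.Good C.low.Represents raw

/-- Morphisms are refinements: maps over `S` between disjoint unions of balls which arise from
sequences of gluings of balls. (There is at most one such map for given source and target, as
permissible decompositions are injective on the interiors of the balls.) -/
instance (S : Type) [TopologicalSpace S] : Category.{0} (C.LabDec S) where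
  Hom z z' := {φ : (⟨z.raw.pieces⟩ : C.BallList) ⟶ ⟨z'.raw.pieces⟩ //
    z'.raw.toFun ∘ φ.1 = z.raw.toFun}
  id z := ⟨𝟙 _, rfl⟩
  comp {z _ z''} φ ψ := ⟨φ.1 ≫ ψ.1,
    show (z''.raw.toFun ∘ ψ.1.1) ∘ φ.1.1 = z.raw.toFun by rw [ψ.2, φ.2]⟩

/-- The functor which sends a labelled decomposition to the tensor product of the complexes
of morphisms of its balls. Its left Kan extension along the functor which forgets the labels is
`x ↦ ⨁ ⨂ C(Xₐ; β)` (the sum over the labellings `β` of the `(n-1)`-skeleton of `x`), so both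
have the same homotopy colimit. -/
def psi (S : Type) [TopologicalSpace S] : C.LabDec S ⥤ Ch R where
  obj z := C.tensFunctor.obj ⟨z.raw.pieces⟩
  map φ := C.tensFunctor.map φ.1
  map_id _ := C.tensFunctor.map_id _
  map_comp φ ψ := C.tensFunctor.map_comp φ.1 ψ.1

/-- For a class `P` of labelled decompositions of `S`, the subcomplex of the blob complex of `S`
spanned by the `(x, a)` with all vertices of `x` in `P`. It is a homotopy colimit too. -/
def blob (S : Type) [TopologicalSpace S] (P : ObjectProperty (C.LabDec S)) : Ch R :=
  hocolim (P.ι ⋙ C.psi S)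

/-- The blob complex `B_*(S; C)`: the homotopy colimit of `psi`, along all (labelled) permissible
decompositions of `S`. -/
abbrev blobComplex (S : Type) [TopologicalSpace S] : Ch R := C.blob S ⊤

section

variable {S S' : Type} [TopologicalSpace S] [TopologicalSpace S']

/-- The inclusion of `(x, a)`, for a fixed string `x` of refinements of decompositions in `P`;
here `a` is in the tensor product of the morphism complexes of the balls of `x₀`, and
the string `x` has length `m`. -/
def gen {P : ObjectProperty (C.LabDec S)} {m : ℕ} (x : ComposableArrows P.FullSubcategory m)
    (p d : ℤ) (h : p + m = d) : (C.top.tens (x.obj 0).obj.raw.pieces).X p ⟶ (C.blob S P).X d :=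
  hocolimι (P.ι ⋙ C.psi S) x p d h

/-- The inclusion of subcomplexes. -/
def incl {P P' : ObjectProperty (C.LabDec S)} (h : P ≤ P') : C.blob S P ⟶ C.blob S P' :=
  hocolimMap (ObjectProperty.ιOfLE h) (P'.ι ⋙ C.psi S)

variable {C}

/-- The image of a labelled decomposition under a homeomorphism. -/
def LabDec.homeo (z : C.LabDec S) (a : S ≃ₜ S') : C.LabDec S' where
  raw := z.raw.push a
  good := ⟨z.good.permissible.comp_homeo a,
    (CellData.FacesAgree.push_iff C.low C.low.Represents z.raw a a.injective).2 z.good.agree⟩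

/-- The image of a labelled decomposition of `S` under a gluing `g : S → S'` such that the labels
agree along the submanifolds of `∂S` glued by `g`. -/
def LabDec.glue (z : C.LabDec S) {g : S → S'} (hg : IsGluing n g)
    (h : C.low.FacesAgree C.low.Represents (z.raw.push g)) : C.LabDec S' where
  raw := z.raw.push g
  good := ⟨.step _ g z.good.permissible hg, h⟩

end

end DiskCat

/-- A topological `n`-manifold, possibly with boundary. -/
structure Mfd (n : ℕ) : Type 1 where
  carrier : Type
  [top : TopologicalSpace carrier]
  isMfd : IsMfd n carrier

attribute [instance] Mfd.top

instance (n : ℕ) : CoeSort (Mfd n) Type := ⟨Mfd.carrier⟩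

/-- A gluing `X → X'` of `n`-manifolds. -/
structure Gluing {n : ℕ} (X X' : Mfd n) : Type where
  toFun : X → X'
  isGluing : IsGluing n toFun

/-- Iterated gluings: nonempty sequences of gluings `X → ⋯ → W`. -/
inductive IterGluing {n : ℕ} : Mfd n → Mfd n → Type 1
  | one {X W : Mfd n} (g : Gluing X W) : IterGluing X W
  | cons {X X' W : Mfd n} (g : Gluing X X') (s : IterGluing X' W) : IterGluing X W

/-- The composite map of an iterated gluing. -/
def IterGluing.toFun {n : ℕ} : {X W : Mfd n} → IterGluing X W → X → W
  | _, _, .one g => g.toFun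
  | _, _, .cons g s => s.toFun ∘ g.toFun

namespace DiskCat

variable {n : ℕ} {R : Type 1} [CommRing R] (C : DiskCat n R)

/-- The labelled decompositions `z` of `X` whose labels agree along the submanifolds `Y`, `Yᵒᵖ` of
`∂X` identified by `g`, such that the resulting labelled decomposition of `X'` is in `Q`. -/
def pull {X X' : Mfd n} (g : Gluing X X') (Q : ObjectProperty (C.LabDec X')) :
    ObjectProperty (C.LabDec X) :=
  fun z => ∃ h : C.low.FacesAgree C.low.Represents (z.raw.push g.toFun), Q (z.glue g.isGluing h)

/-- The labelled decompositions `z` of `X` whose labels agree along the submanifolds `Y`, `Yᵒᵖ` of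
`∂X` identified by `g`. -/
abbrev matching {X X' : Mfd n} (g : Gluing X X') : ObjectProperty (C.LabDec X) := C.pull g ⊤

/-- Gluing of labelled decompositions. -/
def glueFunctor {X X' : Mfd n} (g : Gluing X X') (Q : ObjectProperty (C.LabDec X')) :
    (C.pull g Q).FullSubcategory ⥤ Q.FullSubcategory where
  obj z := ⟨z.obj.glue g.isGluing z.property.choose, z.property.choose_spec⟩
  map φ := ObjectProperty.homMk ⟨φ.hom.1, congrArg (g.toFun ∘ ·) φ.hom.2⟩

/-- The labelled decompositions `z` of `X` such that the homeomorphism `a` takes `z` into `Q`. -/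
def homeoPull {X W : Mfd n} (a : X ≃ₜ W) (Q : ObjectProperty (C.LabDec W)) :
    ObjectProperty (C.LabDec X) :=
  fun z => Q (z.homeo a)

/-- The action of homeomorphisms on labelled decompositions. -/
def homeoFunctor {X W : Mfd n} (a : X ≃ₜ W) (Q : ObjectProperty (C.LabDec W)) :
    (C.homeoPull a Q).FullSubcategory ⥤ Q.FullSubcategory where
  obj z := ⟨z.obj.homeo a, z.property⟩
  map φ := ObjectProperty.homMk ⟨φ.hom.1, congrArg (a ∘ ·) φ.hom.2⟩

/-- The action `B_*(X; C) → B_*(W; C)` of a homeomorphism `X ≅ W` (the case `Q = ⊤`), and its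
restrictions to subcomplexes. -/
def homeoMap {X W : Mfd n} (a : X ≃ₜ W) (Q : ObjectProperty (C.LabDec W)) :
    C.blob X (C.homeoPull a Q) ⟶ C.blob W Q :=
  hocolimMap (C.homeoFunctor a Q) (Q.ι ⋙ C.psi W)

/-- For a commutative square of gluings `g`, `h` and homeomorphisms `a`, `b`, the conditions on
labels to be glued along `g` and along `h` correspond to each other. -/
lemma pull_square {X X' W W' : Mfd n} (g : Gluing X X') (h : Gluing W W') (a : X ≃ₜ W)
    (b : X' ≃ₜ W') (comm : h.toFun ∘ a = b ∘ g.toFun) (Q : ObjectProperty (C.LabDec W')) :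
    C.homeoPull a (C.pull h Q) = C.pull g (C.homeoPull b Q) := by
  funext z
  have e : (z.raw.push a).push h.toFun = (z.raw.push g.toFun).push b := by
    change RawDec.mk z.raw.pieces ((h.toFun ∘ a) ∘ z.raw.toFun) = _
    rw [comm]
    rfl
  have e' : C.low.FacesAgree C.low.Represents ((z.raw.push a).push h.toFun) ↔
      C.low.FacesAgree C.low.Represents (z.raw.push g.toFun) := by
    rw [e]
    exact CellData.FacesAgree.push_iff C.low C.low.Represents _ b b.injective
  have key : ∀ h1 h2, (z.homeo a).glue h.isGluing h1 = (z.glue g.isGluing h2).homeo b := by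
    intro h1 h2
    simp only [LabDec.glue, LabDec.homeo, e]
  apply propext
  constructor
  · rintro ⟨h1, hQ⟩
    exact ⟨e'.1 h1, (congrArg Q (key h1 (e'.1 h1))).mp hQ⟩
  · rintro ⟨h2, hQ⟩
    exact ⟨e'.2 h2, (congrArg Q (key (e'.2 h2) h2)).mpr hQ⟩

/-- The labelled decompositions of `X` which can be glued along all gluings of the sequence `s`,
with result in `Q`. -/
def iterPull : {X W : Mfd n} → IterGluing X W → ObjectProperty (C.LabDec W) →
    ObjectProperty (C.LabDec X)
  | _, _, .one g, Q => C.pull g Q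
  | _, _, .cons g s, Q => C.pull g (iterPull s Q)

variable {C} in
/-- The composite of the gluing maps `gl` of an iterated gluing. -/
def iterGlue (gl : ∀ {X X' : Mfd n} (g : Gluing X X') (Q : ObjectProperty (C.LabDec X')),
      C.blob X (C.pull g Q) ⟶ C.blob X' Q) :
    {X W : Mfd n} → (s : IterGluing X W) → (Q : ObjectProperty (C.LabDec W)) →
      (C.blob X (C.iterPull s Q) ⟶ C.blob W Q)
  | _, _, .one g, Q => gl g Q
  | _, _, .cons g s, Q => gl g (C.iterPull s Q) ≫ iterGlue gl s Q

end DiskCat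

end Blob

/-! Gluing does not touch the balls of a labelled decomposition. It only composes the map from their
disjoint union with `g`. The functor `psi` reads nothing but the list of labelled balls and the maps
between disjoint unions, so `psi` of `g ∘ x` and `psi` of `x` are the same complex, definitionally.
Composition with `g` is therefore a functor of index categories over which the two diagrams coincide
strictly, and the gluing map is the induced map of homotopy colimits, `(x, a) ↦ (g ∘ x, a)`.

The same description applies to the action of a homeomorphism and to the inclusion of a subcomplex
(composition with the identity). So every map in the statement is an instance of one construction,
`PushesTo.blobMap`, attached to a map of spaces `f` that carries a class `P` of labelled
decompositions into a class `Q`. Two facts carry the proof: this construction is multiplicative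
(`PushesTo.blobMap_comp`), and for fixed `P` and `Q` it depends only on the map `f`
(`PushesTo.blobMap_congr`).

Each required identity of chain maps thereby becomes an identity of maps of spaces: the commutative
square `h ∘ a = b ∘ g` for naturality, and the equality of the two composites for associativity. No
homotopies or sign computations occur, and neither the axioms of an `n`-category nor the geometry of
gluings is needed beyond what makes the classes and functors well defined. -/

namespace Blob

/-! ### Functoriality of the homotopy colimit in its index category -/

section Hocolim

/-- Both sides carry the summand of a string `x` identically onto the summand of `x ⋙ Φ ⋙ Ψ`.
Composition of functors is associative by definition, so no transport between summands is needed. -/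
lemma replPush_comp {J J' J'' : Type 1} [Category.{0} J] [Category.{0} J'] [Category.{0} J'']
    {V : Type 2} [Category.{1} V] [HasCoproducts.{1} V] (Φ : J ⥤ J') (Ψ : J' ⥤ J'')
    (F : J'' ⥤ V) (m : ℕ) :
    replPush Φ (Ψ ⋙ F) m ≫ replPush Ψ F m = replPush (Φ ⋙ Ψ) F m := by
  -- The two sides have sources indexed by different bracketings of the same triple composite, so
  -- one bracketing is fixed here. The equalities below hold up to such unfolding and are therefore
  -- chained as terms.
  apply repl_hom_ext (F := Φ ⋙ Ψ ⋙ F)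
  intro x
  refine (Category.assoc _ _ _).symm.trans ?_
  refine (congrArg (· ≫ replPush Ψ F m) (replι_push Φ (Ψ ⋙ F) x)).trans ?_
  exact (replι_push Ψ F (x ⋙ Φ)).trans (replι_push (Φ ⋙ Ψ) F x).symm

/-- The map of simplicial replacements `(x, a) ↦ (Φ x, a)`. -/
def simplicialReplacementMap {J J' : Type 1} [Category.{0} J] [Category.{0} J']
    {V : Type 2} [Category.{1} V] [HasCoproducts.{1} V] (Φ : J ⥤ J') (F : J' ⥤ V) :
    simplicialReplacement (Φ ⋙ F) ⟶ simplicialReplacement F where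
  app m := replPush Φ F m.unop.len
  naturality _ _ θ := repl_hom_ext _ fun x => replι_naturality Φ F θ.unop.toOrderHom x

variable {R : Type 1} [CommRing R]
  {J J' J'' : Type 1} [Category.{0} J] [Category.{0} J'] [Category.{0} J'']

/-- The map of homotopy colimits is obtained from a map of simplicial objects by three functorial
operations: alternating face map complex, flip, total complex. Each preserves composition, which
leaves the levelwise identity `replPush_comp`. -/
lemma hocolimMap_comp (Φ : J ⥤ J') (Ψ : J' ⥤ J'') (F : J'' ⥤ Ch R) :
    hocolimMap Φ (Ψ ⋙ F) ≫ hocolimMap Ψ F = hocolimMap (Φ ⋙ Ψ) F := by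
  refine (HomologicalComplex₂.total.map_comp _ _ _).symm.trans ?_
  refine congrArg (fun t => HomologicalComplex₂.total.map t _) ?_
  refine (Functor.map_comp _ _ _).symm.trans ?_
  refine congrArg (fun t => (HomologicalComplex₂.flipFunctor _ _ _).map t) ?_
  -- The natural transformations are anonymous inside `hocolimMap`. Naming them exhibits the two
  -- factors as images of composable morphisms of simplicial objects.
  refine (Functor.map_comp (AlgebraicTopology.alternatingFaceMapComplex (Ch R))
    (simplicialReplacementMap Φ (Ψ ⋙ F)) (simplicialReplacementMap Ψ F)).symm.trans ?_
  refine congrArg (fun t => (AlgebraicTopology.alternatingFaceMapComplex (Ch R)).map t)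
    (?_ : _ = simplicialReplacementMap (Φ ⋙ Ψ) F)
  apply NatTrans.ext
  funext m
  exact replPush_comp Φ Ψ F m.unop.len

/-- A map of total complexes restricts, on the summand of bidegree `(p, m)`, to the corresponding
component of the map of double complexes. Here that component is `replPush` in chain degree `p`,
which is known on each string. -/
lemma hocolimι_map (Φ : J ⥤ J') (F : J' ⥤ Ch R) {m : ℕ} (x : ComposableArrows J m) (p d : ℤ)
    (h : p + m = d) :
    hocolimι (Φ ⋙ F) x p d h ≫ (hocolimMap Φ F).f d = hocolimι F (x ⋙ Φ) p d h := by
  refine (Category.assoc _ _ _).trans ?_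
  refine (congrArg ((replι (Φ ⋙ F) x).f p ≫ ·)
    (HomologicalComplex₂.ιTotal_map _ _ _ _ p m d h)).trans ?_
  refine (Category.assoc _ _ _).symm.trans ?_
  refine congrArg (· ≫ HomologicalComplex₂.ιTotal _ _ p m d h) ?_
  exact congrArg (fun t : (Φ ⋙ F).obj (x.obj 0) ⟶ repl F m => t.f p) (replι_push Φ F x)

end Hocolim

namespace DiskCat

variable {n : ℕ} {R : Type 1} [CommRing R] (C : DiskCat n R)

/-! ### Chain maps of blob complexes along maps of spaces -/

section Push

variable {S S' S'' : Type} [TopologicalSpace S] [TopologicalSpace S'] [TopologicalSpace S'']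

/-- The map `f` takes labelled decompositions in `P` to labelled decompositions in `Q`. -/
def PushesTo (f : S → S') (P : ObjectProperty (C.LabDec S)) (Q : ObjectProperty (C.LabDec S')) :
    Prop :=
  ∀ z, P z → ∃ h : C.low.Good C.low.Represents (z.raw.push f), Q ⟨z.raw.push f, h⟩

variable {C} in
-- Pushing along `f` and then along `g` is by definition pushing along `g ∘ f`, so the second
-- hypothesis applies directly to the output of the first.
lemma PushesTo.comp {f : S → S'} {g : S' → S''} {P : ObjectProperty (C.LabDec S)}
    {Q : ObjectProperty (C.LabDec S')} {Q' : ObjectProperty (C.LabDec S'')}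
    (hg : C.PushesTo g Q Q') (hf : C.PushesTo f P Q) : C.PushesTo (g ∘ f) P Q' := fun z hz =>
  let ⟨_, hQ⟩ := hf z hz
  hg _ hQ

variable {C} in
/-- The functor `z ↦ f ∘ z` on labelled decompositions. -/
def PushesTo.functor {f : S → S'} {P : ObjectProperty (C.LabDec S)}
    {Q : ObjectProperty (C.LabDec S')} (hf : C.PushesTo f P Q) :
    P.FullSubcategory ⥤ Q.FullSubcategory where
  obj z := ⟨⟨z.obj.raw.push f, (hf z.obj z.property).choose⟩, (hf z.obj z.property).choose_spec⟩
  map φ := ObjectProperty.homMk ⟨φ.hom.1, congrArg (f ∘ ·) φ.hom.2⟩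

variable {C} in
/-- The chain map `(x, a) ↦ (f ∘ x, a)`. -/
def PushesTo.blobMap {f : S → S'} {P : ObjectProperty (C.LabDec S)}
    {Q : ObjectProperty (C.LabDec S')} (hf : C.PushesTo f P Q) : C.blob S P ⟶ C.blob S' Q :=
  hocolimMap hf.functor (Q.ι ⋙ C.psi S')

variable {C} in
-- The composite of the two index functors is definitionally the functor of `g ∘ f`, since they
-- differ only in proofs that the pushed decompositions are good and lie in the class. Functoriality
-- of homotopy colimits then gives the claim.
lemma PushesTo.blobMap_comp {f : S → S'} {g : S' → S''} {P : ObjectProperty (C.LabDec S)}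
    {Q : ObjectProperty (C.LabDec S')} {Q' : ObjectProperty (C.LabDec S'')}
    (hf : C.PushesTo f P Q) (hg : C.PushesTo g Q Q') :
    hf.blobMap ≫ hg.blobMap = (hg.comp hf).blobMap :=
  hocolimMap_comp hf.functor hg.functor (Q'.ι ⋙ C.psi S'')

variable {C} in
-- Once the maps are identified, `hf` and `hf'` are two proofs of one proposition. This is what
-- turns equations between maps of spaces into equations between chain maps.
lemma PushesTo.blobMap_congr {f f' : S → S'} {P : ObjectProperty (C.LabDec S)}
    {Q : ObjectProperty (C.LabDec S')} (hf : C.PushesTo f P Q) (hf' : C.PushesTo f' P Q)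
    (h : f = f') : hf.blobMap = hf'.blobMap := by
  subst h
  rfl

lemma pushesTo_id {P P' : ObjectProperty (C.LabDec S)} (h : P ≤ P') : C.PushesTo id P P' :=
  fun z hz => ⟨z.good, h z hz⟩

/-- Pushing along `id` returns the same decomposition definitionally, so inclusions of subcomplexes
fall under the same construction. -/
lemma incl_eq {P P' : ObjectProperty (C.LabDec S)} (h : P ≤ P') :
    C.incl h = (C.pushesTo_id h).blobMap := rfl

end Push

/-! ### Gluings, homeomorphisms and iterated gluings -/

lemma pushesTo_glue {X X' : Mfd n} (g : Gluing X X') (Q : ObjectProperty (C.LabDec X')) :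
    C.PushesTo g.toFun (C.pull g Q) Q := fun z ⟨h, hQ⟩ => ⟨(z.glue g.isGluing h).good, hQ⟩

lemma pushesTo_homeo {X W : Mfd n} (a : X ≃ₜ W) (Q : ObjectProperty (C.LabDec W)) :
    C.PushesTo a (C.homeoPull a Q) Q := fun z hz => ⟨(z.homeo a).good, hz⟩

/-- The gluing map `(x, a) ↦ (g ∘ x, a)`. -/
def glueMap {X X' : Mfd n} (g : Gluing X X') (Q : ObjectProperty (C.LabDec X')) :
    C.blob X (C.pull g Q) ⟶ C.blob X' Q :=
  (C.pushesTo_glue g Q).blobMap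

lemma gen_glueMap {X X' : Mfd n} (g : Gluing X X') (Q : ObjectProperty (C.LabDec X')) {m : ℕ}
    (x : ComposableArrows (C.pull g Q).FullSubcategory m) (p d : ℤ) (h : p + m = d) :
    C.gen x p d h ≫ (C.glueMap g Q).f d = C.gen (x ⋙ C.glueFunctor g Q) p d h :=
  hocolimι_map (C.glueFunctor g Q) (Q.ι ⋙ C.psi X') x p d h

lemma pushesTo_iterGlue {X W : Mfd n} (s : IterGluing X W) (Q : ObjectProperty (C.LabDec W)) :
    C.PushesTo s.toFun (C.iterPull s Q) Q := by
  induction s with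
  | one g => exact C.pushesTo_glue g Q
  | cons g s ih => exact (ih Q).comp (C.pushesTo_glue g _)

/-- By multiplicativity a composite of gluing maps collapses to a single chain map attached to
`s.toFun`. The intermediate manifolds survive only in the class `iterPull s Q` on which it is
defined. -/
lemma iterGlue_glueMap {X W : Mfd n} (s : IterGluing X W) (Q : ObjectProperty (C.LabDec W)) :
    iterGlue C.glueMap s Q = (C.pushesTo_iterGlue s Q).blobMap := by
  induction s with
  | one g => rfl
  | cons g s ih =>
    refine (congrArg (C.glueMap g (C.iterPull s Q) ≫ ·) (ih Q)).trans ?_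
    exact PushesTo.blobMap_comp _ _

end DiskCat

end Blob

theorem mainTheorem10 (n : ℕ) (R : Type 1) [CommRing R] (C : Blob.DiskCat n R) :
    ∃ gl : ∀ {X X' : Blob.Mfd n} (g : Blob.Gluing X X') (Q : ObjectProperty (C.LabDec X')),
        C.blob X (C.pull g Q) ⟶ C.blob X' Q,
      -- the chain map is induced by gluing labelled decompositions
      (∀ {X X' : Blob.Mfd n} (g : Blob.Gluing X X') (Q : ObjectProperty (C.LabDec X')) (m : ℕ)
        (x : ComposableArrows (C.pull g Q).FullSubcategory m) (p d : ℤ) (h : p + m = d),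
        C.gen x p d h ≫ (gl g Q).f d = C.gen (x ⋙ C.glueFunctor g Q) p d h) ∧
      -- naturality with respect to homeomorphisms
      (∀ {X X' W W' : Blob.Mfd n} (g : Blob.Gluing X X') (h : Blob.Gluing W W') (a : X ≃ₜ W)
        (b : X' ≃ₜ W') (comm : h.toFun ∘ a = b ∘ g.toFun) (Q : ObjectProperty (C.LabDec W')),
        C.homeoMap a (C.pull h Q) ≫ gl h Q =
          C.incl (C.pull_square g h a b comm Q).le ≫ gl g (C.homeoPull b Q) ≫ C.homeoMap b Q) ∧
      -- associativity: two iterated gluings with the same composite induce the same map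
      (∀ {X W : Blob.Mfd n} (s s' : Blob.IterGluing X W), s.toFun = s'.toFun →
        ∀ Q : ObjectProperty (C.LabDec W),
        C.incl (inf_le_left : C.iterPull s Q ⊓ C.iterPull s' Q ≤ C.iterPull s Q) ≫
            Blob.DiskCat.iterGlue gl s Q =
          C.incl (inf_le_right : C.iterPull s Q ⊓ C.iterPull s' Q ≤ C.iterPull s' Q) ≫
            Blob.DiskCat.iterGlue gl s' Q) := by
  refine ⟨C.glueMap, fun g Q m x p d h => C.gen_glueMap g Q x p d h, ?_, ?_⟩
  · intro X X' W W' g h a b comm Q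
    -- All the maps involved unfold to the single construction. The inclusion on the right serves
    -- only to pass between two classes that are equal by `pull_square` but not definitionally so.
    change (C.pushesTo_homeo a _).blobMap ≫ (C.pushesTo_glue h Q).blobMap =
      (C.pushesTo_id (C.pull_square g h a b comm Q).le).blobMap ≫ (C.pushesTo_glue g _).blobMap ≫
        (C.pushesTo_homeo b Q).blobMap
    rw [Blob.DiskCat.PushesTo.blobMap_comp, Blob.DiskCat.PushesTo.blobMap_comp,
      Blob.DiskCat.PushesTo.blobMap_comp]
    -- The two sides are now attached to `h ∘ a` and to `b ∘ g` preceded by the identity, which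
    -- disappears definitionally.
    exact Blob.DiskCat.PushesTo.blobMap_congr _ _ comm
  · intro X W s s' hs Q
    -- Each of the classes `iterPull s Q` and `iterPull s' Q` asks for agreement of labels at the
    -- stages of its own sequence. After restriction to the intersection both sides have the same
    -- source and target, and differ only in the map of spaces.
    rw [C.iterGlue_glueMap, C.iterGlue_glueMap, C.incl_eq, C.incl_eq,
      Blob.DiskCat.PushesTo.blobMap_comp, Blob.DiskCat.PushesTo.blobMap_comp]
    exact Blob.DiskCat.PushesTo.blobMap_congr _ _ hs
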